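/- A finite poset is $(\mathbf{2+2})$-free if it has no induced subposet isomorphic to the disjoint union of two $2$-element chains. For $n\ge 1$ let $\mathcal P_n$ be the set of unlabeled $(\mathbf{2+2})$-free posets with $n$ elements, that is, of such posets up to isomorphism. For $P\in\mathcal P_n$ put $D(x)=\{y\in P: y<x\}$. The sets $D(x)$, $x\in P$, are linearly ordered by inclusion; write them as $\emptyset=D_0\subsetneq D_1\subsetneq\dots\subsetneq D_k$ and put $\operatorname{rank}(P)=k$. An element $x$ is at level $i$ if $D(x)=D_i$; $L_i$ is the set of elements at level $i$; $\operatorname{srank}(P)$ is the minimum level containing a maximal element. Removal. Let $n\ge2$, $P\in\mathcal P_n$ and $i=\operatorname{srank}(P)$. If $|L_i|>1$, remove one of the maximal elements at level $i$. If $|L_i|=1$ and $i=\operatorname{rank}(P)$, remove the unique element at level $i$. If $|L_i|=1$ and $i<\operatorname{rank}(P)$, delete all relations $x<y$ with $x\in D_{i+1}\setminus D_i$ and then remove the unique element at level $i$. The result $Q$ is a well-defined element of $\mathcal P_{n-1}$, and we write $\psi(P)=(Q,i)$. Addition. Let $n\ge2$, $Q\in\mathcal P_{n-1}$ and $0\le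 i\le 1+\operatorname{rank}(Q)$; the poset $\varphi(Q,i)\in\mathcal P_n$ is obtained from $Q$ by adding a new maximal element as follows. If $i\le\operatorname{srank}(Q)$, the strict down-set of the new element is $D_i(Q)$. If $i=1+\operatorname{rank}(Q)$, the new element is larger than all elements of $Q$. If $\operatorname{srank}(Q)<i\le\operatorname{rank}(Q)$, the strict down-set of the new element is $D_i(Q)$ and, moreover, all relations $x\le y$ are added where $x\le z$ for some maximal element $z$ of $Q$ of level less than $i$ and $y$ is an element of $Q$ of level at least $i$. For a sequence $x=(x_1,\dots,x_n)$ of nonnegative integers let $\operatorname{asc}(x)=|\{1\le j<n: x_j<x_{j+1}\}|$. The sequence $x$ is an ascent sequence of length $n$ if $x_1=0$ and $x_i\le 1+\operatorname{asc}(x_1,\dots,x_{i-1})$ for $2\le i\le n$. Define $\Psi$ recursively: $\Psi$ sends the one-element poset to $(0)$, and for $n\ge 2$ and $P\in\mathcal P_n$ with $\psi(P)=(Q,i)$ and $\Psi(Q)=(x_1,\dots,x_{n-1})$, put $\Psi(P)=(x_1,\dots,x_{n-1},i)$. **Theorem.** For every $n\ge1$ the map $\Psi$ is a bijection from $\mathcal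 P_n$ onto the set of ascent sequences of length $n$. For every $P\in\mathcal P_n$ with $\Psi(P)=x=(x_1,\dots,x_n)$ one has $\operatorname{rank}(P)=\operatorname{asc}(x)$ and $\operatorname{srank}(P)=x_n$. Moreover, for every $Q\in\mathcal P_n$ with $\Psi(Q)=(x_1,\dots,x_n)$ and every $0\le i\le 1+\operatorname{rank}(Q)$ one has $\Psi(\varphi(Q,i))=(x_1,\dots,x_n,i)$. -/

import Mathlib

namespace TwoPlusTwo

/-! ### Ascent sequences -/

/-- The number of ascents of `x`: the indices `j` such that the entry following `x j` exists
and is larger than `x j`. -/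
noncomputable def asc {n : ℕ} (x : Fin n → ℕ) : ℕ :=
  {j : Fin n | ∃ h : (j : ℕ) + 1 < n, x j < x ⟨(j : ℕ) + 1, h⟩}.ncard

/-- The initial segment formed by the entries of `x` strictly before position `i`. -/
def initSeg {n : ℕ} (x : Fin n → ℕ) (i : Fin n) : Fin (i : ℕ) → ℕ :=
  fun j => x (Fin.castLE i.isLt.le j)

/-- Ascent sequences: the first entry is `0`, and every later entry is at most one more than
the number of ascents of the entries before it. -/
def IsAscentSeq {n : ℕ} (x : Fin n → ℕ) : Prop :=
  (∀ h : 0 < n, x ⟨0, h⟩ = 0) ∧ ∀ i : Fin n, 0 < (i : ℕ) → x i ≤ 1 + asc (initSeg x i)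

/-! ### Levels of a poset

In Mathlib the strict down-set `D(x)` is `Set.Iio x`. -/

/-- No induced subposet is isomorphic to the disjoint union of two chains of two elements
(the order of a sum type in Mathlib is that of the disjoint union). -/
def IsFree (α : Type*) [PartialOrder α] : Prop :=
  IsEmpty (Fin 2 ⊕ Fin 2 ↪o α)

/-- The set `D(P)` of all strict down-sets of elements. -/
def downsets (α : Type*) [PartialOrder α] : Set (Set α) :=
  Set.range (Set.Iio : α → Set α)

/-- If `D(P) = {D₀ ⊂ D₁ ⊂ ⋯ ⊂ D_k}` then the rank of the poset is `k`. -/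
noncomputable def rank (α : Type*) [PartialOrder α] : ℕ :=
  (downsets α).ncard - 1

/-- The level of `x`, that is, the index of `D(x)` in the chain `D₀ ⊂ D₁ ⊂ ⋯ ⊂ D_k`. -/
noncomputable def level {α : Type*} [PartialOrder α] (x : α) : ℕ :=
  {S : Set α | S ∈ downsets α ∧ S ⊂ Set.Iio x}.ncard

/-- `L_i`, the set of elements at level `i`. -/
def levelSet (α : Type*) [PartialOrder α] (i : ℕ) : Set α :=
  {x : α | level x = i}

/-- `D_i`, the common strict down-set of the elements at level `i` (empty if there are none). -/
def levelDown (α : Type*) [PartialOrder α] (i : ℕ) : Set α :=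
  {y : α | ∃ z ∈ levelSet α i, y < z}

/-- The minimum level containing a maximal element. -/
noncomputable def srank (α : Type*) [PartialOrder α] : ℕ :=
  sInf {i : ℕ | ∃ x : α, IsMax x ∧ level x = i}

section basic

variable {α β : Type*} [PartialOrder α] [PartialOrder β]

theorem isFree_iff : IsFree α ↔ ∀ a b c d : α, a < b → c < d → a < d ∨ c < b := by
  constructor
  · intro h a b c d hab hcd
    by_contra hcon
    push Not at hcon
    obtain ⟨had, hcb⟩ := hcon
    have h1 : ¬ a ≤ c := fun h => had (lt_of_le_of_lt h hcd)
    have h2 : ¬ c ≤ a := fun h => hcb (lt_of_le_of_lt h hab)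
    have h3 : ¬ b ≤ d := fun h => had (lt_of_lt_of_le hab h)
    have h4 : ¬ d ≤ b := fun h => hcb (lt_of_lt_of_le hcd h)
    have h5 : ¬ a ≤ d := fun h => h.lt_or_eq.elim had (fun e => h2 (e ▸ hcd.le))
    have h6 : ¬ c ≤ b := fun h => h.lt_or_eq.elim hcb (fun e => h1 (e ▸ hab.le))
    have h7 : ¬ b ≤ c := fun h => h1 (hab.le.trans h)
    have h8 : ¬ d ≤ a := fun h => h2 (hcd.le.trans h)
    refine h.false (OrderEmbedding.ofMapLEIff (Sum.elim ![a, b] ![c, d]) ?_)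
    rintro (u | u) (v | v) <;> fin_cases u <;> fin_cases v <;>
      simp [h1, h2, h3, h4, h5, h6, h7, h8, hab.le, hcd.le, hab.not_ge, hcd.not_ge]
  · intro h
    refine ⟨fun f => ?_⟩
    have e1 : f (Sum.inl 0) < f (Sum.inl 1) := by simp
    have e2 : f (Sum.inr 0) < f (Sum.inr 1) := by simp
    rcases h _ _ _ _ e1 e2 with h | h <;> simp at h

theorem IsFree.of_orderIso (e : α ≃o β) (h : IsFree α) : IsFree β :=
  ⟨fun f => h.false (f.trans e.symm.toOrderEmbedding)⟩

theorem IsFree.iio_total (h : IsFree α) (u v : α) :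
    Set.Iio u ⊆ Set.Iio v ∨ Set.Iio v ⊆ Set.Iio u := by
  by_contra hcon
  simp only [not_or, Set.not_subset] at hcon
  obtain ⟨⟨a, ha, ha'⟩, c, hc, hc'⟩ := hcon
  rcases isFree_iff.1 h a u c v ha hc with h | h
  · exact ha' h
  · exact hc' h

theorem level_lt_of_iio [Finite α] {u v : α} (h : Set.Iio u ⊂ Set.Iio v) :
    level u < level v := by
  apply Set.ncard_lt_ncard _ (Set.toFinite _)
  refine ⟨fun S hS => ⟨hS.1, hS.2.trans h⟩, fun hsub => ?_⟩
  exact (hsub ⟨⟨u, rfl⟩, h⟩ : _ ∧ _).2.ne rfl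

theorem level_lt [Finite α] {u v : α} (h : u < v) : level u < level v :=
  level_lt_of_iio ⟨fun _ hw => lt_trans hw h, fun hs => lt_irrefl u (hs h)⟩

theorem level_le [Finite α] {u v : α} (h : u ≤ v) : level u ≤ level v := by
  rcases h.lt_or_eq with h | h
  · exact (level_lt h).le
  · rw [h]

theorem IsFree.iio_subset [Finite α] (h : IsFree α) {u v : α} (huv : level u ≤ level v) :
    Set.Iio u ⊆ Set.Iio v := by
  by_contra hcon
  have h1 := (h.iio_total u v).resolve_left hcon
  exact absurd (level_lt_of_iio ⟨h1, hcon⟩) (not_lt.2 huv)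

theorem iio_map (e : α ≃o β) (x : α) : Set.Iio (e x) = e '' Set.Iio x :=
  (e.image_Iio x).symm

theorem rank_eq (e : α ≃o β) : rank α = rank β := by
  have : downsets β = (fun S => e '' S) '' downsets α := by
    ext S
    constructor
    · rintro ⟨y, rfl⟩
      exact ⟨_, ⟨e.symm y, rfl⟩, by simp⟩
    · rintro ⟨_, ⟨x, rfl⟩, rfl⟩
      exact ⟨e x, iio_map e x⟩
  rw [rank, rank, this, Set.ncard_image_of_injective _ e.injective.image_injective]

theorem image_ssubset (e : α ≃o β) {S T : Set α} : e '' S ⊂ e '' T ↔ S ⊂ T := by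
  rw [ssubset_iff_subset_not_subset, ssubset_iff_subset_not_subset,
    Set.image_subset_image_iff e.injective, Set.image_subset_image_iff e.injective]

theorem level_eq (e : α ≃o β) (x : α) : level (e x) = level x := by
  have : {S : Set β | S ∈ downsets β ∧ S ⊂ Set.Iio (e x)} =
      (fun S => e '' S) '' {S : Set α | S ∈ downsets α ∧ S ⊂ Set.Iio x} := by
    ext S
    constructor
    · rintro ⟨⟨y, rfl⟩, hS⟩
      have h := iio_map e (e.symm y)
      rw [e.apply_symm_apply] at h
      refine ⟨_, ⟨⟨e.symm y, rfl⟩, ?_⟩, h.symm⟩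
      rw [h, iio_map e x] at hS
      exact (image_ssubset e).1 hS
    · rintro ⟨_, ⟨⟨x', rfl⟩, hS⟩, rfl⟩
      refine ⟨⟨e x', iio_map e x'⟩, ?_⟩
      rw [iio_map]
      exact (image_ssubset e).2 hS
  rw [level, level, this, Set.ncard_image_of_injective _ e.injective.image_injective]

theorem isMax_map (e : α ≃o β) (x : α) : IsMax (e x) ↔ IsMax x :=
  e.isMax_apply

theorem srank_eq (e : α ≃o β) : srank α = srank β := by
  unfold srank
  congr 1
  ext i
  constructor
  · rintro ⟨x, hx, hi⟩
    exact ⟨e x, (isMax_map e x).2 hx, by rw [level_eq, hi]⟩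
  · rintro ⟨y, hy, hi⟩
    exact ⟨e.symm y, (isMax_map e.symm y).2 hy, by rw [level_eq, hi]⟩

theorem mem_levelSet_map (e : α ≃o β) (i : ℕ) (x : α) :
    e x ∈ levelSet β i ↔ x ∈ levelSet α i := by
  simp [levelSet, level_eq]

theorem ncard_levelSet_eq (e : α ≃o β) (i : ℕ) :
    (levelSet α i).ncard = (levelSet β i).ncard := by
  have : levelSet β i = e '' levelSet α i := by
    ext y
    obtain ⟨x, rfl⟩ := e.surjective y
    rw [mem_levelSet_map, e.injective.mem_set_image]
  rw [this, Set.ncard_image_of_injective _ e.injective]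

theorem mem_levelDown_map (e : α ≃o β) (i : ℕ) (x : α) :
    e x ∈ levelDown β i ↔ x ∈ levelDown α i := by
  constructor
  · rintro ⟨z, hz, hlt⟩
    exact ⟨e.symm z, (mem_levelSet_map e.symm i z).2 hz, e.lt_symm_apply.2 hlt⟩
  · rintro ⟨z, hz, hlt⟩
    exact ⟨e z, (mem_levelSet_map e i z).2 hz, e.lt_iff_lt.2 hlt⟩

end basic

/-! ### The removal operation -/

/-- The elements that the removal operation may take out: the maximal elements at the minimum
level containing a maximal element. -/
def IsRemovable {α : Type*} [PartialOrder α] (x : α) : Prop :=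
  IsMax x ∧ level x = srank α

/-- The set of elements all of whose relations `y < z` are deleted by the removal operation.
With `i = srank`, it is `D_{i+1} \ D_i` if `L_i` has one element and `i < rank`, and it is
empty in the other two cases. -/
def removalSet (α : Type*) [PartialOrder α] : Set α :=
  {y : α | ((levelSet α (srank α)).ncard = 1 ∧ srank α < rank α) ∧
    y ∈ levelDown α (srank α + 1) \ levelDown α (srank α)}

/-- The elements that remain when `x` is removed. -/
def Removed {α : Type*} (x : α) : Type _ := {y : α // y ≠ x}

/-- The order after removal of `x`: the relations `y < z` with `y` in the removal set are
deleted, all others are kept. -/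
instance Removed.partialOrder {α : Type*} [PartialOrder α] (x : α) :
    PartialOrder (Removed x) where
  le a b := a = b ∨ (a.1 < b.1 ∧ a.1 ∉ removalSet α)
  le_refl a := Or.inl rfl
  le_trans a b c := by
    rintro (rfl | ⟨h1, h2⟩) (rfl | ⟨h3, h4⟩)
    · exact Or.inl rfl
    · exact Or.inr ⟨h3, h4⟩
    · exact Or.inr ⟨h1, h2⟩
    · exact Or.inr ⟨h1.trans h3, h2⟩
  le_antisymm a b := by
    rintro (rfl | ⟨h1, _⟩) (h | ⟨h3, _⟩)
    · rfl
    · rfl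
    · exact h.symm
    · exact absurd h3 (lt_asymm h1)

instance Removed.finite {α : Type*} [Finite α] (x : α) : Finite (Removed x) :=
  inferInstanceAs (Finite {y : α // y ≠ x})

section removal

variable {α β : Type*} [PartialOrder α] [PartialOrder β]

theorem Removed.le_def {x : α} (a b : Removed x) :
    a ≤ b ↔ a = b ∨ (a.1 < b.1 ∧ a.1 ∉ removalSet α) := Iff.rfl

theorem Removed.lt_iff {x : α} (a b : Removed x) :
    a < b ↔ a.1 < b.1 ∧ a.1 ∉ removalSet α := by
  rw [lt_iff_le_and_ne, Removed.le_def]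
  constructor
  · rintro ⟨h | h, hne⟩
    · exact absurd h hne
    · exact h
  · intro h
    exact ⟨Or.inr h, fun e => h.1.ne (congrArg Subtype.val e)⟩

theorem IsFree.removed (h : IsFree α) (x : α) : IsFree (Removed x) := by
  rw [isFree_iff] at h ⊢
  intro a b c d hab hcd
  rw [Removed.lt_iff] at *
  rcases h _ _ _ _ hab.1 hcd.1 with h | h
  · exact Or.inl ⟨h, hab.2⟩
  · exact Or.inr ((Removed.lt_iff c b).2 ⟨h, hcd.2⟩)

theorem card_removed {α : Type*} [Finite α] {n : ℕ} (h : Nat.card α = n + 1) (x : α) :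
    Nat.card (Removed x) = n := by
  classical
  have := Fintype.ofFinite α
  have : Nat.card {y : α // y ≠ x} = n := by
    rw [Nat.card_eq_fintype_card] at *
    have := Fintype.card_subtype_compl (fun y : α => y = x)
    simp at this
    simp [h]
  exact this

theorem mem_removalSet_map (e : α ≃o β) (x : α) :
    e x ∈ removalSet β ↔ x ∈ removalSet α := by
  simp only [removalSet, Set.mem_ofPred_eq, Set.mem_sdiff, mem_levelDown_map, ← srank_eq e,
    ← rank_eq e, ← ncard_levelSet_eq e]

/-- An isomorphism taking `x` to `y` restricts to what remains after the removals. -/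
theorem removed_iso (e : α ≃o β) {x : α} {y : β} (hxy : e x = y) :
    Nonempty (Removed x ≃o Removed y) := by
  subst hxy
  have hne : ∀ a : α, a ≠ x ↔ e a ≠ e x := fun a => by simp
  let f : Removed x ≃ Removed (e x) := e.toEquiv.subtypeEquiv hne
  have hf : ∀ a : Removed x, (f a).1 = e a.1 := fun _ => rfl
  refine ⟨⟨f, ?_⟩⟩
  intro a b
  rw [Removed.le_def, Removed.le_def, f.apply_eq_iff_eq, hf, hf, e.lt_iff_lt, mem_removalSet_map]

/-- Maximal elements with the same strict down-set are exchanged by an automorphism. -/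
theorem exists_swap {x y : α} (hx : IsMax x) (hy : IsMax y) (h : Set.Iio x = Set.Iio y) :
    ∃ e : α ≃o α, e x = y := by
  classical
  have hlt : ∀ a, a < x ↔ a < y := fun a => Set.ext_iff.1 h a
  have hx' : ∀ a, ¬ x < a := fun a => hx.not_lt
  have hy' : ∀ a, ¬ y < a := fun a => hy.not_lt
  refine ⟨⟨Equiv.swap x y, ?_⟩, Equiv.swap_apply_left x y⟩
  intro a b
  rw [le_iff_lt_or_eq, le_iff_lt_or_eq, Equiv.apply_eq_iff_eq]
  apply or_congr_left
  simp only [Equiv.swap_apply_def]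
  split_ifs <;> simp_all

theorem exists_removable [Finite α] [Nonempty α] : ∃ x : α, IsRemovable x := by
  obtain ⟨m, hm⟩ := Set.finite_univ.exists_maximal (Set.univ_nonempty (α := α))
  have : {i : ℕ | ∃ x : α, IsMax x ∧ level x = i}.Nonempty :=
    ⟨_, m, fun b hb => hm.2 (Set.mem_univ b) hb, rfl⟩
  exact Nat.sInf_mem this

/-- The result of the removal operation depends, up to isomorphism, neither on the choice of
the removable element nor on the representative of the isomorphism class. -/
theorem removed_iso_of_removable [Finite β] (hβ : IsFree β) (e : α ≃o β) {x : α} {y : β}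
    (hx : IsRemovable x) (hy : IsRemovable y) : Nonempty (Removed x ≃o Removed y) := by
  have hex : level (e x) = level y := by rw [level_eq, hx.2, hy.2, srank_eq e]
  obtain ⟨s, hs⟩ := exists_swap ((isMax_map e x).2 hx.1) hy.1
    (Set.Subset.antisymm (hβ.iio_subset hex.le) (hβ.iio_subset hex.ge))
  exact removed_iso (e.trans s) hs

end removal

/-! ### The addition operation -/

/-- The elements after the addition of a new element `none` at level `i`. -/
def Added (α : Type*) (_i : ℕ) : Type _ := Option α

/-- The relation `a < b` is created by the addition at level `i` if `srank < i ≤ rank`, `a` is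
below some maximal element of level less than `i`, and `b` has level at least `i`. -/
def IsCreated {α : Type*} [PartialOrder α] (i : ℕ) (a b : α) : Prop :=
  (srank α < i ∧ i ≤ rank α) ∧ (∃ z : α, IsMax z ∧ level z < i ∧ a ≤ z) ∧ i ≤ level b

/-- The order after addition. The new element `none` is maximal; its strict down-set is the set
of all old elements if `i = 1 + rank`, and `D_i` if `i ≤ rank`. -/
def Added.le {α : Type*} [PartialOrder α] (i : ℕ) : Option α → Option α → Prop
  | none, none => True
  | none, some _ => False
  | some a, none => i = 1 + rank α ∨ a ∈ levelDown α i
  | some a, some b => a ≤ b ∨ IsCreated i a b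

instance Added.partialOrder (α : Type*) [PartialOrder α] [Finite α] (i : ℕ) :
    PartialOrder (Added α i) where
  le := Added.le i
  le_refl a := by
    cases a with
    | none => trivial
    | some a => exact Or.inl le_rfl
  le_trans a b c := by
    rcases a with _ | a <;> rcases b with _ | b <;> rcases c with _ | c <;>
      simp only [Added.le] <;> try tauto
    · rintro (h1 | h1) (h2 | ⟨w, hw, h2⟩)
      · exact Or.inl h2
      · exact Or.inr ⟨w, hw, lt_of_le_of_lt h1 h2⟩
      · exact Or.inl h2
      · have h3 := level_lt h2
        have h4 := h1.2.2
        have h5 : level w = i := hw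
        omega
    · rintro (h1 | h1) (h2 | h2)
      · exact Or.inl (h1.trans h2)
      · obtain ⟨hi, ⟨z, hz, hzi, hbz⟩, hc⟩ := h2
        exact Or.inr ⟨hi, ⟨z, hz, hzi, h1.trans hbz⟩, hc⟩
      · exact Or.inr ⟨h1.1, h1.2.1, h1.2.2.trans (level_le h2)⟩
      · exact Or.inr ⟨h1.1, h1.2.1, h2.2.2⟩
  le_antisymm a b := by
    rcases a with _ | a <;> rcases b with _ | b <;> simp only [Added.le] <;> try tauto
    have key : ∀ {a b : α}, IsCreated i a b → level a < level b := by
      rintro a b ⟨_, ⟨z, _, hzi, haz⟩, hb⟩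
      have := level_le haz
      omega
    rintro (h1 | h1) (h2 | h2)
    · exact congrArg some (le_antisymm h1 h2)
    · exact absurd (level_le h1) (not_le.2 (key h2))
    · exact absurd (level_le h2) (not_le.2 (key h1))
    · exact absurd (key h1) (lt_asymm (key h2))

instance Added.finite (α : Type*) [Finite α] (i : ℕ) : Finite (Added α i) :=
  inferInstanceAs (Finite (Option α))

section addition

variable {α β : Type*} [PartialOrder α] [PartialOrder β] [Finite α] [Finite β]

theorem card_added {α : Type*} [Finite α] {n : ℕ} (h : Nat.card α = n) (i : ℕ) : Nat.card (Added α i) = n + 1 := by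
  have : Nat.card (Option α) = n + 1 := by rw [Finite.card_option, h]
  exact this

theorem Added.le_def {i : ℕ} (a b : Added α i) : a ≤ b ↔ Added.le i a b := Iff.rfl

theorem Added.none_lt {i : ℕ} (b : Added α i) : ¬ (show Added α i from none) < b := by
  intro h
  cases b with
  | none => exact lt_irrefl _ h
  | some b => exact h.le

theorem Added.some_lt_none {i : ℕ} (a : α) :
    (show Added α i from some a) < (show Added α i from none) ↔
      i = 1 + rank α ∨ a ∈ levelDown α i := by
  rw [lt_iff_le_and_ne]
  exact ⟨fun h => h.1, fun h => ⟨h, fun e => Option.some_ne_none a e⟩⟩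

theorem Added.some_lt_some {i : ℕ} (a b : α) :
    (show Added α i from some a) < (show Added α i from some b) ↔
      a < b ∨ IsCreated i a b := by
  rw [lt_iff_le_and_ne]
  constructor
  · rintro ⟨h | h, hne⟩
    · exact Or.inl (lt_of_le_of_ne h fun e => hne (congrArg some e))
    · exact Or.inr h
  · rintro (h | h)
    · exact ⟨Or.inl h.le, fun e => h.ne (Option.some_injective _ e)⟩
    · refine ⟨Or.inr h, fun e => ?_⟩
      obtain rfl : a = b := Option.some_injective _ e
      obtain ⟨_, ⟨z, _, hzi, haz⟩, hb⟩ := h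
      have := level_le haz
      omega

theorem IsFree.added (h : IsFree α) (i : ℕ) : IsFree (Added α i) := by
  have hs : ∀ {a u v : α}, level u ≤ level v → a < u → a < v :=
    fun huv ha => h.iio_subset huv ha
  have hmix : ∀ {a b c d : α}, a < b → IsCreated i c d → a < d ∨ IsCreated i c b := by
    intro a b c d hab hcd
    by_cases hb : i ≤ level b
    · exact Or.inr ⟨hcd.1, hcd.2.1, hb⟩
    · exact Or.inl (hs (by have := hcd.2.2; omega) hab)
  have htop : ∀ {a c d : α}, a ∈ levelDown α i → (c < d ∨ IsCreated i c d) →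
      a < d ∨ c ∈ levelDown α i := by
    rintro a c d ⟨w, hw, haw⟩ hcd
    have hw' : level w = i := hw
    by_cases hd : i ≤ level d
    · exact Or.inl (hs (by omega) haw)
    · rcases hcd with hcd | hcd
      · exact Or.inr ⟨w, hw, hs (by omega) hcd⟩
      · exact absurd hcd.2.2 hd
  have h' := isFree_iff.1 h
  rw [isFree_iff]
  intro a b c d hab hcd
  rcases a with _ | a
  · exact absurd hab (Added.none_lt _)
  rcases c with _ | c
  · exact absurd hcd (Added.none_lt _)
  rcases b with _ | b <;> rcases d with _ | d
  · exact Or.inl hab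
  · have h1 := (Added.some_lt_none a).1 hab
    have h2 := (Added.some_lt_some c d).1 hcd
    rcases h1 with h1 | h1
    · exact Or.inr ((Added.some_lt_none c).2 (Or.inl h1))
    · rcases htop h1 h2 with h3 | h3
      · exact Or.inl ((Added.some_lt_some a d).2 (Or.inl h3))
      · exact Or.inr ((Added.some_lt_none c).2 (Or.inr h3))
  · have h1 := (Added.some_lt_some a b).1 hab
    have h2 := (Added.some_lt_none c).1 hcd
    rcases h2 with h2 | h2
    · exact Or.inl ((Added.some_lt_none a).2 (Or.inl h2))
    · rcases htop h2 h1 with h3 | h3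
      · exact Or.inr ((Added.some_lt_some c b).2 (Or.inl h3))
      · exact Or.inl ((Added.some_lt_none a).2 (Or.inr h3))
  · have h1 := (Added.some_lt_some a b).1 hab
    have h2 := (Added.some_lt_some c d).1 hcd
    have goal : (a < d ∨ IsCreated i a d) ∨ (c < b ∨ IsCreated i c b) := by
      rcases h1 with h1 | h1 <;> rcases h2 with h2 | h2
      · rcases h' _ _ _ _ h1 h2 with h3 | h3
        · exact Or.inl (Or.inl h3)
        · exact Or.inr (Or.inl h3)
      · rcases hmix h1 h2 with h3 | h3
        · exact Or.inl (Or.inl h3)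
        · exact Or.inr (Or.inr h3)
      · rcases hmix h2 h1 with h3 | h3
        · exact Or.inr (Or.inl h3)
        · exact Or.inl (Or.inr h3)
      · exact Or.inl (Or.inr ⟨h1.1, h1.2.1, h2.2.2⟩)
    rcases goal with h3 | h3
    · exact Or.inl ((Added.some_lt_some a d).2 h3)
    · exact Or.inr ((Added.some_lt_some c b).2 h3)

theorem isCreated_map (e : α ≃o β) (i : ℕ) (a b : α) :
    IsCreated i (e a) (e b) ↔ IsCreated i a b := by
  unfold IsCreated
  rw [srank_eq e, rank_eq e, level_eq, e.surjective.exists]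
  simp only [isMax_map, level_eq, e.le_iff_le]

theorem added_iso (e : α ≃o β) (i : ℕ) : Nonempty (Added α i ≃o Added β i) := by
  let f : Added α i ≃ Added β i := Equiv.optionCongr e.toEquiv
  refine ⟨⟨f, ?_⟩⟩
  intro a b
  rw [Added.le_def, Added.le_def]
  rcases a with _ | a <;> rcases b with _ | b
  · exact Iff.rfl
  · exact Iff.rfl
  · change (i = 1 + rank β ∨ e a ∈ levelDown β i) ↔ (i = 1 + rank α ∨ a ∈ levelDown α i)
    rw [rank_eq e, mem_levelDown_map]
  · change (e a ≤ e b ∨ IsCreated i (e a) (e b)) ↔ (a ≤ b ∨ IsCreated i a b)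
    rw [e.le_iff_le, isCreated_map]

end addition

/-! ### Unlabeled posets and the map to ascent sequences -/

/-- A `(2+2)`-free poset with `n` elements. -/
structure FreePoset (n : ℕ) : Type 1 where
  carrier : Type
  [order : PartialOrder carrier]
  [finite : Finite carrier]
  card_eq : Nat.card carrier = n
  free : IsFree carrier

attribute [instance] FreePoset.order FreePoset.finite

/-- Isomorphism of posets. -/
instance FreePoset.setoid (n : ℕ) : Setoid (FreePoset n) where
  r P Q := Nonempty (P.carrier ≃o Q.carrier)
  iseqv :=
    ⟨fun _ => ⟨OrderIso.refl _⟩, fun ⟨e⟩ => ⟨e.symm⟩, fun ⟨e⟩ ⟨f⟩ => ⟨e.trans f⟩⟩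

/-- Unlabeled `(2+2)`-free posets with `n` elements: isomorphism classes. -/
def UPoset (n : ℕ) : Type 1 := Quotient (FreePoset.setoid n)

/-- The rank of an unlabeled poset. -/
noncomputable def UPoset.rank {n : ℕ} (P : UPoset n) : ℕ :=
  Quotient.lift (s := FreePoset.setoid n) (fun P : FreePoset n => TwoPlusTwo.rank P.carrier)
    (fun _ _ ⟨e⟩ => rank_eq e) P

/-- The minimum level of an unlabeled poset containing a maximal element. -/
noncomputable def UPoset.srank {n : ℕ} (P : UPoset n) : ℕ :=
  Quotient.lift (s := FreePoset.setoid n) (fun P : FreePoset n => TwoPlusTwo.srank P.carrier)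
    (fun _ _ ⟨e⟩ => srank_eq e) P

theorem FreePoset.exists_removable {n : ℕ} (P : FreePoset (n + 1)) :
    ∃ x : P.carrier, IsRemovable x := by
  have : Nonempty P.carrier := by
    apply (Nat.card_pos_iff.1 _).1
    rw [P.card_eq]
    exact Nat.succ_pos n
  exact TwoPlusTwo.exists_removable

/-- The removal of the element `x`. -/
def FreePoset.remove {n : ℕ} (P : FreePoset (n + 1)) (x : P.carrier) : FreePoset n where
  carrier := Removed x
  card_eq := card_removed P.card_eq x
  free := P.free.removed x

/-- The removal operation on unlabeled posets: one of the removable elements is removed. -/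
noncomputable def UPoset.remove {n : ℕ} (P : UPoset (n + 1)) : UPoset n :=
  Quotient.lift (s := FreePoset.setoid (n + 1))
    (fun P : FreePoset (n + 1) =>
      (Quotient.mk _ (P.remove P.exists_removable.choose) : UPoset n))
    (fun P Q ⟨e⟩ => Quotient.sound (removed_iso_of_removable Q.free e
      P.exists_removable.choose_spec Q.exists_removable.choose_spec)) P

/-- The pair formed by the poset after removal and the level of the removed element. -/
noncomputable def UPoset.psi {n : ℕ} (P : UPoset (n + 1)) : UPoset n × ℕ :=
  (P.remove, P.srank)

/-- The addition of an element at level `i` (meant for `i ≤ 1 + rank`). -/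
def FreePoset.add {n : ℕ} (Q : FreePoset n) (i : ℕ) : FreePoset (n + 1) where
  carrier := Added Q.carrier i
  card_eq := card_added Q.card_eq i
  free := Q.free.added i

/-- The addition operation on unlabeled posets. -/
def UPoset.add {n : ℕ} (Q : UPoset n) (i : ℕ) : UPoset (n + 1) :=
  Quotient.lift (s := FreePoset.setoid n) (fun Q : FreePoset n => (Quotient.mk _ (Q.add i) : UPoset (n + 1)))
    (fun _ _ ⟨e⟩ => Quotient.sound (added_iso e i)) Q

/-- The map from unlabeled `(2+2)`-free posets with `n + 1` elements to sequences of length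
`n + 1`. The one-element poset is sent to `(0)`; a larger poset `P` with `psi P = (Q, i)` is
sent to the sequence of `Q` followed by `i`. -/
noncomputable def Psi : (n : ℕ) → UPoset (n + 1) → (Fin (n + 1) → ℕ)
  | 0, _ => fun _ => 0
  | n + 1, P => Fin.snoc (α := fun _ => ℕ) (Psi n P.psi.1) P.psi.2

end TwoPlusTwo

/-!
A `(2+2)`-free poset is an interval order: it has an essentially unique *canonical
representation* by left endpoints `l` and right endpoints `r` with `a < b ↔ r a ≤ l b`, in which
the left endpoints fill `{0, …, k}` and the right endpoints fill `{1, …, k + 1}`. The left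
endpoint is then the level, `k` is the rank, and the maximal elements are those with right
endpoint `k + 1`. Adding an element at level `i ≤ srank` adds the interval `[i, k + 1)`. Adding
one at level `i > srank` first opens a new level `i`: left endpoints `≥ i` and right endpoints
`> i` move up by one, except that the maximal elements of level less than `i` now end at `i + 1`
(at `i` if `i = k + 1`). Removal either drops one of several intervals starting at `i`, or closes
the level `i`, and the two moves are mutually inverse on endpoints. So every poset with more than
one element is obtained by exactly one addition, and `Ψ` records the levels of the successive
additions.
-/

namespace TwoPlusTwo

section representation

variable {α β : Type*} [PartialOrder α] [PartialOrder β]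

/-- The canonical representation of an interval order: `a` is represented by the half-open
interval `[l a, r a)`, with left endpoints onto `{0, …, k}`. Right endpoints are at most `k + 1`
and take every value in `{1, …, k}`; the value `k + 1`, attained by the maximal elements, comes
for free. -/
structure IsCanonicalRep (l r : α → ℕ) (k : ℕ) : Prop where
  lt_iff : ∀ {a b : α}, a < b ↔ r a ≤ l b
  left_le : ∀ a, l a ≤ k
  right_le : ∀ a, r a ≤ k + 1
  exists_left_eq : ∀ j ≤ k, ∃ a, l a = j
  exists_right_eq : ∀ j < k, ∃ a, r a = j + 1

theorem ncard_image_eq_ncard_image {ι β γ : Type*} {f : ι → β} {g : ι → γ}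
    (h : ∀ a b, f a = f b ↔ g a = g b) (s : Set ι) : (f '' s).ncard = (g '' s).ncard := by
  rcases isEmpty_or_nonempty γ with hγ | hγ
  · have := Function.isEmpty g
    simp only [Set.eq_empty_of_isEmpty s, Set.image_empty, Set.ncard_empty]
  obtain ⟨e, rfl⟩ := (Function.factorsThrough_iff g).1 fun a b hab => (h a b).1 hab
  have he : Set.InjOn e (f '' s) := by
    rintro _ ⟨a, -, rfl⟩ _ ⟨b, -, rfl⟩ hab
    exact (h a b).2 hab
  rw [Set.image_comp, he.ncard_image]

namespace IsCanonicalRep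

variable {l r : α → ℕ} {k i : ℕ}

theorem left_lt_right (h : IsCanonicalRep l r k) (a : α) : l a < r a :=
  not_le.1 fun hra => lt_irrefl a (h.lt_iff.2 hra)

theorem isMax_iff (h : IsCanonicalRep l r k) {a : α} : IsMax a ↔ k < r a := by
  rw [isMax_iff_forall_not_lt]
  constructor
  · intro ha
    obtain ⟨b, hb⟩ := h.exists_left_eq k le_rfl
    exact hb ▸ not_le.1 (mt h.lt_iff.2 (ha b))
  · exact fun ha b hab => ha.not_ge ((h.lt_iff.1 hab).trans (h.left_le b))

theorem Iio_subset_Iio_iff (h : IsCanonicalRep l r k) {u v : α} :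
    Set.Iio u ⊆ Set.Iio v ↔ l u ≤ l v := by
  constructor
  · intro hsub
    by_contra! hvu
    obtain ⟨a, ha⟩ := h.exists_right_eq (l u - 1) (by have := h.left_le u; omega)
    have hau : a < u := h.lt_iff.2 (by omega)
    have hav : r a ≤ l v := h.lt_iff.1 (hsub hau)
    omega
  · exact fun huv a ha => h.lt_iff.2 ((h.lt_iff.1 ha).trans huv)

theorem ncard_image_Iio (h : IsCanonicalRep l r k) {j : ℕ} (hj : j ≤ k + 1) :
    (Set.Iio '' {u : α | l u < j}).ncard = j := by
  have hker : ∀ u v : α, Set.Iio u = Set.Iio v ↔ l u = l v := fun u v => by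
    rw [Set.Subset.antisymm_iff, h.Iio_subset_Iio_iff, h.Iio_subset_Iio_iff, le_antisymm_iff]
  have himage : l '' {u | l u < j} = Set.Iio j := by
    ext m
    constructor
    · rintro ⟨u, hu, rfl⟩
      exact hu
    · intro hm
      obtain ⟨u, rfl⟩ := h.exists_left_eq m (Nat.lt_succ_iff.1 (lt_of_lt_of_le hm hj))
      exact ⟨u, hm, rfl⟩
  rw [ncard_image_eq_ncard_image hker, himage, Set.ncard_Iio_nat]

theorem level_eq (h : IsCanonicalRep l r k) (x : α) : level x = l x := by
  have hbelow : {S : Set α | S ∈ downsets α ∧ S ⊂ Set.Iio x} = Set.Iio '' {u | l u < l x} := by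
    ext S
    constructor
    · rintro ⟨⟨u, rfl⟩, hu⟩
      exact ⟨u, not_le.1 fun hxu => hu.2 (h.Iio_subset_Iio_iff.2 hxu), rfl⟩
    · rintro ⟨u, hu, rfl⟩
      exact ⟨⟨u, rfl⟩, h.Iio_subset_Iio_iff.2 (le_of_lt hu),
        fun hxu => not_le.2 hu (h.Iio_subset_Iio_iff.1 hxu)⟩
  rw [level, hbelow, h.ncard_image_Iio ((h.left_le x).trans k.le_succ)]

theorem rank_eq (h : IsCanonicalRep l r k) : rank α = k := by
  have hall : {u : α | l u < k + 1} = Set.univ :=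
    Set.eq_univ_of_forall fun u => Nat.lt_succ_of_le (h.left_le u)
  rw [rank, downsets, ← Set.image_univ, ← hall, h.ncard_image_Iio le_rfl, Nat.add_sub_cancel]

theorem mem_levelDown_iff (h : IsCanonicalRep l r k) (hi : i ≤ k) {a : α} :
    a ∈ levelDown α i ↔ r a ≤ i := by
  constructor
  · rintro ⟨z, hz, haz⟩
    exact (h.lt_iff.1 haz).trans ((h.level_eq z).symm.trans hz).le
  · intro ha
    obtain ⟨z, hz⟩ := h.exists_left_eq i hi
    exact ⟨z, (h.level_eq z).trans hz, h.lt_iff.2 (ha.trans hz.ge)⟩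

theorem srank_le_left (h : IsCanonicalRep l r k) {a : α} (ha : k < r a) : srank α ≤ l a :=
  Nat.sInf_le ⟨a, h.isMax_iff.2 ha, h.level_eq a⟩

theorem exists_left_eq_srank (h : IsCanonicalRep l r k) : ∃ m : α, k < r m ∧ l m = srank α := by
  obtain ⟨a, ha⟩ := h.exists_left_eq k le_rfl
  have ha_max : IsMax a := h.isMax_iff.2 (ha ▸ h.left_lt_right a)
  obtain ⟨m, hm, hml⟩ :=
    Nat.sInf_mem (s := {i | ∃ x : α, IsMax x ∧ level x = i}) ⟨_, a, ha_max, rfl⟩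
  exact ⟨m, h.isMax_iff.1 hm, (h.level_eq m).symm.trans hml⟩

theorem srank_le (h : IsCanonicalRep l r k) : srank α ≤ k := by
  obtain ⟨m, -, hm⟩ := h.exists_left_eq_srank
  exact hm ▸ h.left_le m

theorem isRemovable_iff (h : IsCanonicalRep l r k) {x : α} :
    IsRemovable x ↔ k < r x ∧ ∀ y, k < r y → l x ≤ l y := by
  rw [IsRemovable, h.isMax_iff, h.level_eq]
  refine and_congr_right fun hx => ⟨fun hxs y hy => hxs ▸ h.srank_le_left hy, fun hmin => ?_⟩
  obtain ⟨m, hm, hml⟩ := h.exists_left_eq_srank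
  exact le_antisymm (hml ▸ hmin m hm) (h.srank_le_left hx)

theorem left_eq_srank (h : IsCanonicalRep l r k) {x : α} (hx : IsRemovable x) :
    l x = srank α :=
  (h.level_eq x).symm.trans hx.2

theorem nonempty_orderIso {l' r' : β → ℕ} {k' : ℕ} (h : IsCanonicalRep l r k)
    (h' : IsCanonicalRep l' r' k') (e : α ≃ β) (hl : ∀ a, l' (e a) = l a)
    (hr : ∀ a, r' (e a) = r a) : Nonempty (α ≃o β) :=
  ⟨OrderIso.ofRelIsoLT ⟨e, by intro a b; rw [h.lt_iff, h'.lt_iff, hl, hr]⟩⟩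

end IsCanonicalRep

/-- The right endpoint of `a` in the canonical representation: the number of strict down-sets
that do not contain `a`. As these form an initial segment of `D₀ ⊂ D₁ ⊂ ⋯ ⊂ D_k`, it is the
least `j` with `a ∈ D_j`, and `k + 1` if `a` is maximal. -/
noncomputable def colevel (a : α) : ℕ :=
  {S : Set α | S ∈ downsets α ∧ a ∉ S}.ncard

theorem IsFree.lt_iff_colevel_le_level [Finite α] (h : IsFree α) {a b : α} :
    a < b ↔ colevel a ≤ level b := by
  constructor
  · intro hab
    refine Set.ncard_le_ncard ?_ (Set.toFinite _)
    rintro _ ⟨⟨u, rfl⟩, hau⟩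
    exact ⟨⟨u, rfl⟩, (h.iio_total u b).resolve_right fun hbu => hau (hbu hab),
      fun hbu => hau (hbu hab)⟩
  · contrapose!
    intro hab
    refine Set.ncard_lt_ncard ⟨?_, fun hsub => ?_⟩ (Set.toFinite _)
    · exact fun S hS => ⟨hS.1, fun haS => hab (hS.2.1 haS)⟩
    · exact (hsub ⟨⟨b, rfl⟩, hab⟩).2.ne rfl

theorem level_lt_ncard_downsets [Finite α] (x : α) : level x < (downsets α).ncard :=
  Set.ncard_lt_ncard ⟨fun _ hS => hS.1, fun hsub => (hsub ⟨x, rfl⟩).2.ne rfl⟩ (Set.toFinite _)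

theorem IsFree.level_eq_level_iff [Finite α] (h : IsFree α) (u v : α) :
    level u = level v ↔ Set.Iio u = Set.Iio v :=
  ⟨fun huv => (h.iio_subset huv.le).antisymm (h.iio_subset huv.ge),
    fun huv => by rw [level, level, huv]⟩

theorem IsFree.range_level [Finite α] (h : IsFree α) :
    Set.range (level : α → ℕ) = Set.Iio (downsets α).ncard := by
  refine Set.eq_of_subset_of_ncard_le ?_ ?_ (Set.finite_Iio _)
  · rintro _ ⟨x, rfl⟩
    exact level_lt_ncard_downsets x
  · rw [Set.ncard_Iio_nat, downsets, ← Set.image_univ, ← Set.image_univ,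
      ncard_image_eq_ncard_image h.level_eq_level_iff]

theorem IsFree.isCanonicalRep [Finite α] [Nonempty α] (h : IsFree α) :
    IsCanonicalRep (level : α → ℕ) colevel (rank α) := by
  have hcard : (downsets α).ncard = rank α + 1 :=
    (Nat.succ_pred_eq_of_pos
      ((Nat.zero_le _).trans_lt (level_lt_ncard_downsets (Classical.arbitrary α)))).symm
  have hrange : ∀ j, j ∈ Set.range (level : α → ℕ) ↔ j ≤ rank α := fun j => by
    rw [h.range_level, hcard, Set.mem_Iio, Nat.lt_succ_iff]
  refine ⟨h.lt_iff_colevel_le_level, fun a => (hrange _).1 ⟨a, rfl⟩, fun a => ?_,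
    fun j hj => (hrange j).2 hj, fun j hj => ?_⟩
  · exact (Set.ncard_le_ncard (fun _ hS => hS.1) (Set.toFinite _)).trans hcard.le
  · obtain ⟨u, hu⟩ := (hrange j).2 hj.le
    obtain ⟨v, hv⟩ := (hrange (j + 1)).2 hj
    have hvu : ¬ Set.Iio v ⊆ Set.Iio u := fun hsub => by
      have huv := (h.level_eq_level_iff u v).2 ((h.iio_subset (by omega)).antisymm hsub)
      omega
    obtain ⟨a, hav, hau⟩ := Set.not_subset.1 hvu
    have hle := h.lt_iff_colevel_le_level.1 hav
    have hlt := mt h.lt_iff_colevel_le_level.2 hau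
    exact ⟨a, by omega⟩

end representation

section endpoints

variable {i k p q m : ℕ}

/-- A left endpoint after the insertion of a level `i`. -/
def shiftUp (i m : ℕ) : ℕ :=
  if m < i then m else m + 1

/-- A left endpoint other than `i` after the deletion of the level `i`. -/
def shiftDown (i m : ℕ) : ℕ :=
  if m < i then m else m - 1

/-- The right endpoint of the interval `[p, m)` after the addition of a new maximal element above
level `srank` of a poset of rank `k`: `k < m` says that the interval is that of a maximal
element. -/
def openRight (i k p m : ℕ) : ℕ :=
  if m ≤ i then m else if k < m ∧ p < i then i + 1 else m + 1

/-- The right endpoint `m` after the deletion of the level `i`, leaving a poset of rank `k`: the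
elements with `m = i + 1` become maximal. -/
def closeRight (i k m : ℕ) : ℕ :=
  if m ≤ i then m else if m = i + 1 then k + 1 else m - 1

theorem shiftDown_shiftUp : shiftDown i (shiftUp i m) = m := by
  grind [shiftUp, shiftDown]

theorem shiftUp_shiftDown (hm : m ≠ i) : shiftUp i (shiftDown i m) = m := by
  grind [shiftUp, shiftDown]

theorem shiftUp_ne : shiftUp i m ≠ i := by
  grind [shiftUp]

theorem closeRight_openRight (hm : m ≤ k + 1) :
    closeRight i k (openRight i k p m) = m := by
  grind [openRight, closeRight]

theorem openRight_closeRight (hpm : p < m) (hpi : p ≠ i) (hmax : k + 1 < m → i ≤ p)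
    (hi : i ≤ k + 1) :
    openRight i k (shiftDown i p) (closeRight i k m) = m := by
  grind [openRight, closeRight, shiftDown]

theorem openRight_le_iff : openRight i k p m ≤ i ↔ m ≤ i := by
  grind [openRight]

theorem openRight_le_shiftUp_iff (hm : m ≤ k + 1) (hq : q ≤ k) :
    openRight i k p m ≤ shiftUp i q ↔ m ≤ q ∨ i ≤ k ∧ (k < m ∧ p < i) ∧ i ≤ q := by
  grind [openRight, shiftUp]

theorem closeRight_le_shiftDown_iff (hpi : p ≠ i) (hqi : q ≠ i) (hmax : k + 1 < m → i ≤ p)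
    (hp : p ≤ k + 1) (hq : q ≤ k + 1) :
    closeRight i k m ≤ shiftDown i q ↔ m ≤ q ∧ ¬ (i < k + 1 ∧ m = i + 1) := by
  grind [closeRight, shiftDown]

end endpoints

section addition

variable {α β : Type*} {i : ℕ}

/-- An element of the poset, as an element after the addition. -/
def Added.old (i : ℕ) (a : α) : Added α i :=
  (some a : Option α)

/-- The element that the addition adds. -/
def Added.new (α : Type*) (i : ℕ) : Added α i :=
  (none : Option α)

/-- The function on `Added α i` that takes the value `b` at the new element and extends `f`. -/
def Added.elim (b : β) (f : α → β) (a : Added α i) : β :=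
  Option.elim (show Option α from a) b f

theorem Added.elim_new (b : β) (f : α → β) : (Added.new α i).elim b f = b := rfl

theorem Added.elim_old (b : β) (f : α → β) (a : α) : (Added.old i a).elim b f = f a := rfl

@[elab_as_elim, induction_eliminator]
theorem Added.induction {motive : Added α i → Prop} (new : motive (Added.new α i))
    (old : ∀ a, motive (Added.old i a)) : ∀ a, motive a
  | none => new
  | some a => old a

theorem Added.old_ne_new (a : α) : Added.old i a ≠ Added.new α i :=
  Option.some_ne_none a

namespace IsCanonicalRep

variable [PartialOrder α] {l r : α → ℕ} {k : ℕ}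

theorem exists_openRight_eq (h : IsCanonicalRep l r k) (hs : srank α < i) (hi : i ≤ k + 1)
    {j : ℕ} (hj : j ≤ k) : ∃ a, openRight i k (l a) (r a) = j + 1 := by
  obtain ⟨m, hm, hml⟩ := h.exists_left_eq_srank
  have hmk := h.right_le m
  rcases lt_trichotomy j i with hji | rfl | hij
  · rcases hj.lt_or_eq with hjk | rfl
    · obtain ⟨a, ha⟩ := h.exists_right_eq j hjk
      exact ⟨a, by grind [openRight]⟩
    · exact ⟨m, by grind [openRight]⟩
  · exact ⟨m, by grind [openRight]⟩
  · obtain ⟨a, ha⟩ := h.exists_right_eq (j - 1) (by omega)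
    exact ⟨a, by grind [openRight]⟩

variable [Finite α]

theorem old_lt_new_iff (h : IsCanonicalRep l r k) (hi : i ≤ k + 1) (a : α) :
    Added.old i a < Added.new α i ↔ r a ≤ i := by
  refine (Added.some_lt_none a).trans ?_
  rw [h.rank_eq]
  rcases Nat.le_succ_iff.1 hi with hik | rfl
  · rw [h.mem_levelDown_iff hik, or_iff_right (by omega)]
  · exact iff_of_true (Or.inl (k.add_comm 1)) (h.right_le a)

theorem old_lt_old_iff (h : IsCanonicalRep l r k) (a b : α) :
    Added.old i a < Added.old i b ↔
      r a ≤ l b ∨ (srank α < i ∧ i ≤ k) ∧ (k < r a ∧ l a < i) ∧ i ≤ l b := by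
  refine (Added.some_lt_some a b).trans ?_
  simp only [IsCreated, h.lt_iff, h.rank_eq, h.level_eq, h.isMax_iff]
  constructor
  · rintro (hab | ⟨hi, ⟨z, hz, hzi, haz⟩, hib⟩)
    · exact Or.inl hab
    · rcases haz.lt_or_eq with haz | rfl
      · have := h.lt_iff.1 haz
        exact Or.inl (by omega)
      · exact Or.inr ⟨hi, ⟨hz, hzi⟩, hib⟩
  · exact Or.imp_right fun ⟨hi, ⟨ha, hai⟩, hib⟩ => ⟨hi, ⟨a, ha, hai, le_rfl⟩, hib⟩

theorem added_of_le_srank (h : IsCanonicalRep l r k) (hi : i ≤ srank α) :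
    IsCanonicalRep (α := Added α i) (Added.elim i l) (Added.elim (k + 1) r) k := by
  have hik : i ≤ k := hi.trans h.srank_le
  have hle : ∀ a : Added α i, a.elim i l ≤ k := fun a => by
    induction a with
    | new => exact hik
    | old a => exact h.left_le a
  refine ⟨fun {a b} => ?_, hle, fun a => ?_, fun j hj => ?_, fun j hj => ?_⟩
  · induction a with
    | new => exact iff_of_false (Added.none_lt b) (Nat.not_le.2 (Nat.lt_succ_of_le (hle b)))
    | old a =>
      induction b with
      | new => exact h.old_lt_new_iff (hik.trans k.le_succ) a
      | old b => exact (h.old_lt_old_iff a b).trans (or_iff_left fun hc => hc.1.1.not_ge hi)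
  · induction a with
    | new => exact le_rfl
    | old a => exact h.right_le a
  · obtain ⟨a, ha⟩ := h.exists_left_eq j hj
    exact ⟨Added.old i a, ha⟩
  · obtain ⟨a, ha⟩ := h.exists_right_eq j hj
    exact ⟨Added.old i a, ha⟩

theorem added_of_srank_lt (h : IsCanonicalRep l r k) (hs : srank α < i) (hi : i ≤ k + 1) :
    IsCanonicalRep (α := Added α i) (Added.elim i fun a => shiftUp i (l a))
      (Added.elim (k + 2) fun a => openRight i k (l a) (r a)) (k + 1) := by
  have hle : ∀ a : Added α i, a.elim i (fun a => shiftUp i (l a)) ≤ k + 1 := fun a => by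
    induction a with
    | new => exact hi
    | old a => have := h.left_le a; grind [shiftUp, Added.elim_old]
  refine ⟨fun {a b} => ?_, hle, fun a => ?_, fun j hj => ?_, fun j hj => ?_⟩
  · induction a with
    | new => exact iff_of_false (Added.none_lt b) (Nat.not_le.2 (Nat.lt_succ_of_le (hle b)))
    | old a =>
      induction b with
      | new => exact (h.old_lt_new_iff hi a).trans openRight_le_iff.symm
      | old b =>
        refine (h.old_lt_old_iff a b).trans ?_
        rw [and_iff_right hs]
        exact (openRight_le_shiftUp_iff (h.right_le a) (h.left_le b)).symm
  · induction a with
    | new => exact le_rfl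
    | old a => have := h.right_le a; grind [openRight, Added.elim_old]
  · rcases lt_trichotomy j i with hji | rfl | hij
    · obtain ⟨a, ha⟩ := h.exists_left_eq j (by omega)
      exact ⟨Added.old i a, by grind [shiftUp, Added.elim_old]⟩
    · exact ⟨Added.new α j, rfl⟩
    · obtain ⟨a, ha⟩ := h.exists_left_eq (j - 1) (by omega)
      exact ⟨Added.old i a, by grind [shiftUp, Added.elim_old]⟩
  · obtain ⟨a, ha⟩ := h.exists_openRight_eq hs hi (Nat.lt_succ_iff.1 hj)
    exact ⟨Added.old i a, ha⟩

theorem isRemovable_new (h : IsCanonicalRep l r k) (hi : i ≤ k + 1) :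
    IsRemovable (Added.new α i) := by
  rcases le_or_gt i (srank α) with hs | hs
  · refine (h.added_of_le_srank hs).isRemovable_iff.2 ⟨k.lt_succ_self, fun y hy => ?_⟩
    induction y with
    | new => exact le_rfl
    | old a => exact hs.trans (h.srank_le_left hy)
  · refine (h.added_of_srank_lt hs hi).isRemovable_iff.2 ⟨(k + 1).lt_succ_self, fun y hy => ?_⟩
    induction y with
    | new => exact le_rfl
    | old a =>
      have := h.right_le a
      simp only [Added.elim_new, Added.elim_old] at hy ⊢
      grind [openRight, shiftUp]

theorem srank_added (h : IsCanonicalRep l r k) (hi : i ≤ k + 1) : srank (Added α i) = i := by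
  have hnew := h.isRemovable_new hi
  rcases le_or_gt i (srank α) with hs | hs
  · exact ((h.added_of_le_srank hs).left_eq_srank hnew).symm
  · exact ((h.added_of_srank_lt hs hi).left_eq_srank hnew).symm

theorem rank_added (h : IsCanonicalRep l r k) (hi : i ≤ k + 1) :
    rank (Added α i) = k + if srank α < i then 1 else 0 := by
  split_ifs with hs
  · exact (h.added_of_srank_lt hs hi).rank_eq
  · exact (h.added_of_le_srank (not_lt.1 hs)).rank_eq

end IsCanonicalRep

end addition

section removal

variable {α : Type*} [PartialOrder α] {l r : α → ℕ} {k : ℕ} {x : α}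

namespace IsCanonicalRep

theorem ncard_levelSet_eq_one_iff (h : IsCanonicalRep l r k) (x : α) :
    (levelSet α (l x)).ncard = 1 ↔ ∀ y ≠ x, l y ≠ l x := by
  have hmem : ∀ y, y ∈ levelSet α (l x) ↔ l y = l x := fun y => by
    rw [levelSet, Set.mem_ofPred_eq, h.level_eq]
  constructor
  · intro hone y hyx hy
    obtain ⟨z, hz⟩ := Set.ncard_eq_one.1 hone
    have hxz : x ∈ ({z} : Set α) := hz ▸ (hmem x).2 rfl
    have hyz : y ∈ ({z} : Set α) := hz ▸ (hmem y).2 hy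
    exact hyx (hyz.trans hxz.symm)
  · intro huniq
    refine Set.ncard_eq_one.2 ⟨x, Set.eq_singleton_iff_unique_mem.2 ⟨(hmem x).2 rfl, ?_⟩⟩
    exact fun y hy => by_contra fun hyx => huniq y hyx ((hmem y).1 hy)

theorem mem_removalSet_iff (h : IsCanonicalRep l r k) (hx : IsRemovable x) {a : α} :
    a ∈ removalSet α ↔ (∀ y ≠ x, l y ≠ l x) ∧ l x < k ∧ r a = l x + 1 := by
  rw [removalSet, Set.mem_ofPred_eq, ← h.left_eq_srank hx, h.rank_eq,
    h.ncard_levelSet_eq_one_iff, and_assoc]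
  refine and_congr_right fun _ => and_congr_right fun hxk => ?_
  rw [Set.mem_sdiff, h.mem_levelDown_iff hxk, h.mem_levelDown_iff hxk.le]
  omega

theorem removed_of_exists_ne (h : IsCanonicalRep l r k) (hx : IsRemovable x)
    (hw : ∃ w ≠ x, l w = l x) :
    IsCanonicalRep (fun a : Removed x => l a.1) (fun a => r a.1) k := by
  obtain ⟨w, hwx, hwl⟩ := hw
  have hxr : k < r x := (h.isRemovable_iff.1 hx).1
  refine ⟨fun {a b} => ?_, fun a => h.left_le a.1, fun a => h.right_le a.1, fun j hj => ?_,
    fun j hj => ?_⟩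
  · rw [Removed.lt_iff, h.lt_iff, h.mem_removalSet_iff hx]
    exact and_iff_left fun ha => ha.1 w hwx hwl
  · obtain ⟨a, ha⟩ := h.exists_left_eq j hj
    rcases eq_or_ne a x with rfl | hax
    · exact ⟨⟨w, hwx⟩, hwl.trans ha⟩
    · exact ⟨⟨a, hax⟩, ha⟩
  · obtain ⟨a, ha⟩ := h.exists_right_eq j hj
    exact ⟨⟨a, by rintro rfl; omega⟩, ha⟩

theorem removed_of_unique (h : IsCanonicalRep l r (k + 1)) (hx : IsRemovable x)
    (huniq : ∀ y ≠ x, l y ≠ l x) :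
    IsCanonicalRep (fun a : Removed x => shiftDown (l x) (l a.1))
      (fun a => closeRight (l x) k (r a.1)) k := by
  obtain ⟨hxr, hxmin⟩ := h.isRemovable_iff.1 hx
  have hxk := h.left_le x
  refine ⟨fun {a b} => ?_, fun a => ?_, fun a => ?_, fun j hj => ?_, fun j hj => ?_⟩
  · rw [Removed.lt_iff, h.lt_iff, h.mem_removalSet_iff hx, and_iff_right huniq]
    exact (closeRight_le_shiftDown_iff (huniq a.1 a.2) (huniq b.1 b.2) (hxmin a.1)
      (h.left_le a.1) (h.left_le b.1)).symm
  · have := h.left_le a.1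
    have := huniq a.1 a.2
    grind [shiftDown]
  · have := h.right_le a.1
    grind [closeRight]
  · obtain ⟨a, ha⟩ := h.exists_left_eq (shiftUp (l x) j) (by grind [shiftUp])
    exact ⟨⟨a, by rintro rfl; exact shiftUp_ne ha.symm⟩, by rw [ha, shiftDown_shiftUp]⟩
  · rcases lt_or_ge j (l x) with hjx | hxj
    · obtain ⟨a, ha⟩ := h.exists_right_eq j (by omega)
      exact ⟨⟨a, by rintro rfl; omega⟩, by grind [closeRight]⟩
    · obtain ⟨a, ha⟩ := h.exists_right_eq (j + 1) (by omega)
      exact ⟨⟨a, by rintro rfl; omega⟩, by grind [closeRight]⟩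

end IsCanonicalRep

end removal

section inverse

variable {α : Type*} [PartialOrder α] {l r : α → ℕ} {k i : ℕ} {x : α}

namespace IsCanonicalRep

theorem nonempty_removed_new_orderIso [Finite α] (h : IsCanonicalRep l r k) (hi : i ≤ k + 1) :
    Nonempty (Removed (Added.new α i) ≃o α) := by
  let e : α ≃ Removed (Added.new α i) :=
    Equiv.ofBijective (fun a => ⟨Added.old i a, Added.old_ne_new a⟩)
      ⟨fun a b hab => Option.some_injective α (congrArg Subtype.val hab), fun ⟨a, ha⟩ => by
        induction a with
        | new => exact absurd rfl ha
        | old a => exact ⟨a, rfl⟩⟩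
  have hnew := h.isRemovable_new hi
  suffices Nonempty (α ≃o Removed (Added.new α i)) from this.map OrderIso.symm
  rcases le_or_gt i (srank α) with hs | hs
  · obtain ⟨w, hw⟩ := h.exists_left_eq i (hs.trans h.srank_le)
    have h' := (h.added_of_le_srank hs).removed_of_exists_ne hnew
      ⟨Added.old i w, Added.old_ne_new w, hw⟩
    exact h.nonempty_orderIso h' e (fun _ => rfl) fun _ => rfl
  · have huniq : ∀ b ≠ Added.new α i, b.elim i (fun a => shiftUp i (l a)) ≠ i := fun b hb => by
      induction b with
      | new => exact absurd rfl hb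
      | old a => exact shiftUp_ne
    have h' := (h.added_of_srank_lt hs hi).removed_of_unique hnew huniq
    exact h.nonempty_orderIso h' e (fun _ => shiftDown_shiftUp)
      fun a => closeRight_openRight (h.right_le a)

theorem nonempty_removed_added_orderIso [Finite α] (h : IsCanonicalRep l r k) (hα : IsFree α)
    (hi : i ≤ k + 1) {y : Added α i} (hy : IsRemovable y) : Nonempty (Removed y ≃o α) := by
  obtain ⟨e⟩ := removed_iso_of_removable (hα.added i) (OrderIso.refl _) hy (h.isRemovable_new hi)
  obtain ⟨f⟩ := h.nonempty_removed_new_orderIso hi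
  exact ⟨e.trans f⟩

theorem nonempty_added_removed_orderIso_of_exists_ne [Finite α] (h : IsCanonicalRep l r k)
    (hx : IsRemovable x) (hw : ∃ w ≠ x, l w = l x) :
    Nonempty (Added (Removed x) (l x) ≃o α) := by
  classical
  obtain ⟨hxr, hxmin⟩ := h.isRemovable_iff.1 hx
  have h' := h.removed_of_exists_ne hx hw
  obtain ⟨m, hm, hml⟩ := h'.exists_left_eq_srank
  have hs : l x ≤ srank (Removed x) := hml ▸ hxmin m.1 hm
  refine (h'.added_of_le_srank hs).nonempty_orderIso h
    (show Added (Removed x) (l x) ≃ α from Equiv.optionSubtypeNe x) (fun a => ?_) fun a => ?_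
  · induction a with
    | new => rfl
    | old a => rfl
  · induction a with
    | new => exact le_antisymm (h.right_le x) hxr
    | old a => rfl

theorem srank_removed_lt (h : IsCanonicalRep l r (k + 1)) (hx : IsRemovable x)
    (huniq : ∀ y ≠ x, l y ≠ l x) : srank (Removed x) < l x := by
  have hxr := (h.isRemovable_iff.1 hx).1
  have hxk := h.left_le x
  obtain ⟨a, ha⟩ := h.exists_right_eq (min (l x) k) (by omega)
  have hax : a ≠ x := by rintro rfl; omega
  have hlt := h.left_lt_right a
  have hne := huniq a hax
  calc srank (Removed x) ≤ shiftDown (l x) (l a) :=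
        (h.removed_of_unique hx huniq).srank_le_left (a := ⟨a, hax⟩) (by grind [closeRight])
    _ < l x := by grind [shiftDown]

theorem nonempty_added_removed_orderIso_of_unique [Finite α] (h : IsCanonicalRep l r (k + 1))
    (hx : IsRemovable x) (huniq : ∀ y ≠ x, l y ≠ l x) :
    Nonempty (Added (Removed x) (l x) ≃o α) := by
  classical
  obtain ⟨hxr, hxmin⟩ := h.isRemovable_iff.1 hx
  have h' := h.removed_of_unique hx huniq
  have hadd := h'.added_of_srank_lt (h.srank_removed_lt hx huniq) (h.left_le x)
  refine hadd.nonempty_orderIso h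
    (show Added (Removed x) (l x) ≃ α from Equiv.optionSubtypeNe x) (fun a => ?_) fun a => ?_
  · induction a with
    | new => rfl
    | old a => exact (shiftUp_shiftDown (huniq a.1 a.2)).symm
  · induction a with
    | new => exact le_antisymm (h.right_le x) hxr
    | old a => exact (openRight_closeRight (h.left_lt_right a.1) (huniq a.1 a.2)
        (hxmin a.1) (h.left_le x)).symm

end IsCanonicalRep

theorem IsFree.exists_added_removed_orderIso [Finite α] [Nontrivial α] (h : IsFree α)
    (hx : IsRemovable x) :
    ∃ i ≤ 1 + rank (Removed x), Nonempty (Added (Removed x) i ≃o α) := by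
  have hrep := h.isCanonicalRep
  by_cases hw : ∃ w ≠ x, level w = level x
  · refine ⟨level x, ?_, hrep.nonempty_added_removed_orderIso_of_exists_ne hx hw⟩
    rw [(hrep.removed_of_exists_ne hx hw).rank_eq]
    exact (hrep.left_le x).trans (Nat.le_add_left _ 1)
  · have huniq : ∀ y ≠ x, level y ≠ level x := fun y hy hyx => hw ⟨y, hy, hyx⟩
    obtain ⟨k, hk⟩ : ∃ k, rank α = k + 1 := by
      obtain ⟨y, hy⟩ := exists_ne x
      have := hrep.left_le x
      have := hrep.left_le y
      have := huniq y hy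
      exact ⟨rank α - 1, by omega⟩
    rw [hk] at hrep
    refine ⟨level x, ?_, hrep.nonempty_added_removed_orderIso_of_unique hx huniq⟩
    rw [(hrep.removed_of_unique hx huniq).rank_eq, add_comm]
    exact hrep.left_le x

end inverse

section sequences

variable {n : ℕ}

theorem asc_eq_sum (x : Fin (n + 1) → ℕ) :
    asc x = ∑ j : Fin n, if x j.castSucc < x j.succ then 1 else 0 := by
  rw [← Finset.card_filter]
  have hasc : {j : Fin (n + 1) | ∃ h : (j : ℕ) + 1 < n + 1, x j < x ⟨(j : ℕ) + 1, h⟩} =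
      Fin.castSucc '' ((Finset.univ.filter fun j : Fin n => x j.castSucc < x j.succ : Finset _) :
        Set (Fin n)) := by
    ext j
    constructor
    · rintro ⟨h, hj⟩
      exact ⟨⟨j, Nat.lt_of_succ_lt_succ h⟩, Finset.mem_filter.2 ⟨Finset.mem_univ _, hj⟩, rfl⟩
    · rintro ⟨k, hk, rfl⟩
      exact ⟨Nat.succ_lt_succ k.isLt, (Finset.mem_filter.1 hk).2⟩
  rw [asc, hasc, Set.ncard_image_of_injective _ (Fin.castSucc_injective n), Set.ncard_coe_finset]

theorem asc_snoc (x : Fin (n + 1) → ℕ) (i : ℕ) :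
    asc (Fin.snoc (α := fun _ => ℕ) x i) = asc x + if x (Fin.last n) < i then 1 else 0 := by
  rw [asc_eq_sum, asc_eq_sum, Fin.sum_univ_castSucc]
  congr 1
  · refine Finset.sum_congr rfl fun j _ => ?_
    rw [← Fin.castSucc_succ, Fin.snoc_castSucc, Fin.snoc_castSucc]
  · rw [Fin.snoc_castSucc, Fin.succ_last, Fin.snoc_last]

theorem isAscentSeq_snoc (x : Fin (n + 1) → ℕ) (i : ℕ) :
    IsAscentSeq (Fin.snoc (α := fun _ => ℕ) x i) ↔ IsAscentSeq x ∧ i ≤ 1 + asc x := by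
  have hzero : (Fin.snoc (α := fun _ => ℕ) x i : Fin (n + 2) → ℕ) ⟨0, Nat.succ_pos _⟩ =
      x ⟨0, Nat.succ_pos _⟩ := Fin.snoc_castSucc (α := fun _ => ℕ) i x ⟨0, Nat.succ_pos _⟩
  have hinit : ∀ j : Fin (n + 1),
      initSeg (Fin.snoc (α := fun _ => ℕ) x i : Fin (n + 2) → ℕ) j.castSucc = initSeg x j :=
    fun j => funext fun k =>
      Fin.snoc_castSucc (α := fun _ => ℕ) i x (Fin.castLE j.isLt.le k)
  have hlast : initSeg (Fin.snoc (α := fun _ => ℕ) x i : Fin (n + 2) → ℕ) (Fin.last (n + 1)) = x :=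
    funext fun k => Fin.snoc_castSucc (α := fun _ => ℕ) i x k
  unfold IsAscentSeq
  rw [Fin.forall_fin_succ', Fin.snoc_last, hlast]
  simp only [hzero, hinit, Fin.snoc_castSucc]
  constructor
  · rintro ⟨ha, hb, hc⟩
    exact ⟨⟨fun _ => ha (Nat.succ_pos _), hb⟩, hc (Nat.succ_pos _)⟩
  · rintro ⟨⟨ha, hb⟩, hc⟩
    exact ⟨fun _ => ha (Nat.succ_pos _), hb, fun _ => hc⟩

theorem isAscentSeq_one_iff (x : Fin 1 → ℕ) : IsAscentSeq x ↔ x = fun _ => 0 := by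
  constructor
  · intro h
    funext j
    rw [Subsingleton.elim j ⟨0, Nat.one_pos⟩]
    exact h.1 Nat.one_pos
  · rintro rfl
    exact ⟨fun _ => rfl, fun _ _ => Nat.zero_le _⟩

end sequences

section unlabeled

variable {n : ℕ}

theorem FreePoset.nonempty_carrier (P : FreePoset (n + 1)) : Nonempty P.carrier :=
  P.exists_removable.nonempty

theorem FreePoset.isCanonicalRep (P : FreePoset (n + 1)) :
    IsCanonicalRep (level : P.carrier → ℕ) colevel (TwoPlusTwo.rank P.carrier) :=
  have := P.nonempty_carrier
  P.free.isCanonicalRep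

theorem FreePoset.isCanonicalRep_one (P : FreePoset 1) :
    IsCanonicalRep (fun _ : P.carrier => 0) (fun _ => 1) 0 := by
  obtain ⟨_, ⟨p⟩⟩ := Nat.card_eq_one_iff_unique.1 P.card_eq
  refine ⟨fun {a b} => ?_, fun _ => le_rfl, fun _ => le_rfl,
    fun j hj => ⟨p, (Nat.le_zero.1 hj).symm⟩, fun j hj => absurd hj j.not_lt_zero⟩
  exact iff_of_false (fun hab => hab.ne (Subsingleton.elim a b)) Nat.one_pos.not_ge

theorem UPoset.srank_add (Q : UPoset (n + 1)) {i : ℕ} (hi : i ≤ 1 + Q.rank) :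
    (Q.add i).srank = i := by
  induction Q using Quotient.inductionOn with
  | h Q => exact Q.isCanonicalRep.srank_added (add_comm 1 _ ▸ hi)

theorem UPoset.rank_add (Q : UPoset (n + 1)) {i : ℕ} (hi : i ≤ 1 + Q.rank) :
    (Q.add i).rank = Q.rank + if Q.srank < i then 1 else 0 := by
  induction Q using Quotient.inductionOn with
  | h Q => exact Q.isCanonicalRep.rank_added (add_comm 1 _ ▸ hi)

theorem UPoset.remove_add (Q : UPoset (n + 1)) {i : ℕ} (hi : i ≤ 1 + Q.rank) :
    (Q.add i).remove = Q := by
  induction Q using Quotient.inductionOn with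
  | h Q =>
    exact Quotient.sound (Q.isCanonicalRep.nonempty_removed_added_orderIso Q.free
      (add_comm 1 _ ▸ hi) (Q.add i).exists_removable.choose_spec)

theorem UPoset.exists_add_eq (P : UPoset (n + 2)) :
    ∃ (Q : UPoset (n + 1)) (i : ℕ), i ≤ 1 + Q.rank ∧ Q.add i = P := by
  induction P using Quotient.inductionOn with
  | h P =>
    have : Nontrivial P.carrier :=
      Finite.one_lt_card_iff_nontrivial.1 (by rw [P.card_eq]; omega)
    obtain ⟨x, hx⟩ := P.exists_removable
    obtain ⟨i, hi, e⟩ := P.free.exists_added_removed_orderIso hx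
    exact ⟨Quotient.mk _ (P.remove x), i, hi, Quotient.sound e⟩

theorem UPoset.subsingleton_one : Subsingleton (UPoset 1) where
  allEq P Q := by
    induction P, Q using Quotient.inductionOn₂ with
    | h P Q =>
      obtain ⟨e⟩ := Finite.card_eq.1 (P.card_eq.trans Q.card_eq.symm)
      exact Quotient.sound (P.isCanonicalRep_one.nonempty_orderIso Q.isCanonicalRep_one e
        (fun _ => rfl) fun _ => rfl)

theorem UPoset.nonempty_one : Nonempty (UPoset 1) :=
  ⟨Quotient.mk _ ⟨Unit, Nat.card_unique, isFree_iff.2 fun _ _ _ _ hab => (hab.ne rfl).elim⟩⟩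

theorem UPoset.rank_eq_zero (P : UPoset 1) : P.rank = 0 := by
  induction P using Quotient.inductionOn with
  | h P => exact P.isCanonicalRep_one.rank_eq

theorem UPoset.srank_eq_zero (P : UPoset 1) : P.srank = 0 := by
  induction P using Quotient.inductionOn with
  | h P => exact Nat.le_zero.1 P.isCanonicalRep_one.srank_le

theorem Psi_succ (P : UPoset (n + 2)) :
    Psi (n + 1) P = Fin.snoc (α := fun _ => ℕ) (Psi n P.remove) P.srank := rfl

theorem Psi_add (Q : UPoset (n + 1)) {i : ℕ} (hi : i ≤ 1 + Q.rank) :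
    Psi (n + 1) (Q.add i) = Fin.snoc (α := fun _ => ℕ) (Psi n Q) i := by
  rw [Psi_succ, Q.remove_add hi, Q.srank_add hi]

theorem srank_eq_Psi_last : ∀ {n : ℕ} (P : UPoset (n + 1)), P.srank = Psi n P (Fin.last n)
  | 0, P => P.srank_eq_zero
  | n + 1, P => by rw [Psi_succ, Fin.snoc_last]

theorem rank_eq_asc_Psi (P : UPoset (n + 1)) : P.rank = asc (Psi n P) := by
  induction n with
  | zero => rw [P.rank_eq_zero, asc_eq_sum, Finset.univ_eq_empty, Finset.sum_empty]
  | succ n ih =>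
    obtain ⟨Q, i, hi, rfl⟩ := P.exists_add_eq
    rw [Psi_add Q hi, asc_snoc, Q.rank_add hi, ← ih, ← srank_eq_Psi_last]

theorem isAscentSeq_Psi (P : UPoset (n + 1)) : IsAscentSeq (Psi n P) := by
  induction n with
  | zero => exact (isAscentSeq_one_iff _).2 rfl
  | succ n ih =>
    obtain ⟨Q, i, hi, rfl⟩ := P.exists_add_eq
    rw [Psi_add Q hi, isAscentSeq_snoc, ← rank_eq_asc_Psi]
    exact ⟨ih Q, hi⟩

theorem Psi_injective (n : ℕ) : Function.Injective (Psi n) := by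
  induction n with
  | zero => exact fun P Q _ => UPoset.subsingleton_one.elim P Q
  | succ n ih =>
    intro P P' h
    obtain ⟨Q, i, hi, rfl⟩ := P.exists_add_eq
    obtain ⟨Q', i', hi', rfl⟩ := P'.exists_add_eq
    rw [Psi_add Q hi, Psi_add Q' hi', Fin.snoc_inj] at h
    rw [ih h.1, h.2]

theorem exists_Psi_eq {x : Fin (n + 1) → ℕ} (hx : IsAscentSeq x) : ∃ P, Psi n P = x := by
  induction n with
  | zero =>
    obtain ⟨P⟩ := UPoset.nonempty_one
    exact ⟨P, ((isAscentSeq_one_iff x).1 hx).symm⟩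
  | succ n ih =>
    induction x using Fin.snocCases with
    | snoc x i =>
      rw [isAscentSeq_snoc] at hx
      obtain ⟨Q, rfl⟩ := ih hx.1
      rw [← rank_eq_asc_Psi] at hx
      exact ⟨Q.add i, Psi_add Q hx.2⟩

end unlabeled

end TwoPlusTwo

theorem theorem3p4 (n : ℕ) :
    Set.BijOn (TwoPlusTwo.Psi n) Set.univ
        {x : Fin (n + 1) → ℕ | TwoPlusTwo.IsAscentSeq x} ∧
      (∀ P : TwoPlusTwo.UPoset (n + 1),
        P.rank = TwoPlusTwo.asc (TwoPlusTwo.Psi n P) ∧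
          P.srank = TwoPlusTwo.Psi n P (Fin.last n)) ∧
      (∀ (Q : TwoPlusTwo.UPoset (n + 1)) (i : ℕ), i ≤ 1 + Q.rank →
        TwoPlusTwo.Psi (n + 1) (Q.add i) =
          Fin.snoc (α := fun _ => ℕ) (TwoPlusTwo.Psi n Q) i) := by
  open TwoPlusTwo in
  exact ⟨⟨fun P _ => isAscentSeq_Psi P, (Psi_injective n).injOn,
      fun _ hx => let ⟨P, hP⟩ := exists_Psi_eq hx; ⟨P, Set.mem_univ P, hP⟩⟩,
    fun P => ⟨rank_eq_asc_Psi P, srank_eq_Psi_last P⟩, fun Q _ hi => Psi_add Q hi⟩
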